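/- **Bivariate flow polynomial.** A *signed graph* $\Sigma=(V,E,\sigma)$ has a finite vertex set $V$, a finite edge set $E$ and signs $\sigma:E\to\{1,-1\}$; each edge has two ends, each connected to one vertex or to none, and at least one of the two is connected to a vertex. Loops and multiple edges are allowed; an *outer-edge* is an edge with only one end connected to a vertex. An *orientation* of an edge $e$ puts an arrow on each of its two ends, the arrows being in the same direction along $e$ if $\sigma(e)=1$ and in opposite directions if $\sigma(e)=-1$; $e$ with an orientation is an *arc* $\vec e$, and $\vec e^{\,-1}$ is the opposite arc. For $v\in V$ let $[v,\vec e\,]$ be the number of ends of $e$ at $v$ whose arrow points to $v$ minus the number of those whose arrow points away from $v$. A *flow* of $\Sigma$ over an abelian group $A$ is a function $f$ from the arcs to $A$ with $f(\vec e^{\,-1})=-f(\vec e\,)$ and $\sum_{e\in E}[v,\vec e\,]f(\vec e\,)=0$ for all $v\in V$. Let $F_{nz}(\Sigma,A)$ be the set of flows that vanish on no arc, and $\mathrm{Tor}_2A=\{a\in A:2a=0\}$. A *circle* is a connected 2-regular subgraph without outer-edges (a loop counts 2 in the degree); it is *positive* if the product of its edge signs is $1$. A component of a signed graph is *compact* if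 it contains no outer-edge, and *balanced* if it is compact and all its circles are positive. For $S\subseteq E$ let $c(S)$, $b(S)$, $u_c(S)$ be the numbers of components, of balanced components, and of compact unbalanced components of the spanning subgraph $(V,S)$, and let $\mathrm{cr}(S)=|S|-|V|+b(S)$. An edge $e$ is a *co-loop* if $b(E\smallsetminus e)=b(E)+1$, and a *bridge* if $c(E\smallsetminus e)=c(E)+1$. **Theorem.** Let $\Sigma$ be a signed graph with $E\neq\varnothing$, and let $R$ be an integral domain of characteristic $0$ (for example $\mathbb Z$ or $\mathbb R$). There is a unique polynomial $\varphi(\Sigma;t,x)\in R[t,x]$ such that $$|F_{nz}(\Sigma,A)|=\varphi\big(\Sigma;|\mathrm{Tor}_2A|,|A|\big)\quad\text{for all finite abelian groups }A.$$ Moreover, $$\varphi(\Sigma;t,x)=\sum_{S\subseteq E}(-1)^{|E\smallsetminus S|}\,t^{u_c(S)}x^{\mathrm{cr}(S)},$$ and $\varphi(\Sigma;t,x)=0$ if and only if $\Sigma$ contains a co-loop that is a bridge or an outer-edge. -/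

import Mathlib

universe u v r w

/-- A signed graph with vertex set `V` and edge set `E` (loops, multiple edges and outer-edges are
allowed). Each edge has exactly two ends, labelled by `Bool`; each end is connected to one vertex
or to none (`none`), at least one of the two ends being connected to a vertex. -/
structure SignedGraph (V : Type u) (E : Type v) where
  ends : E → Bool → Option V
  exists_end : ∀ e, ∃ i x, ends e i = some x
  sign : E → ℤˣ

namespace SignedGraph

variable {V : Type u} {E : Type v}

/-- `x` is an endpoint of the edge `e`. -/
def IsEndpoint (G : SignedGraph V E) (e : E) (x : V) : Prop :=
  ∃ i, G.ends e i = some x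

/-- An outer-edge is an edge having only one end connected to a vertex. -/
def IsOuterEdge (G : SignedGraph V E) (e : E) : Prop :=
  ∃ i, G.ends e i = none

/-! ### Arcs, chains, boundary operator, flows -/

/-- An arc: an edge with an orientation, that is, an arrow on each of its two ends, where
`arrow i = 1` means that the arrow points towards the end `i` (away from the middle of the edge) and
`arrow i = -1` that it points away from the end `i`. The two arrows are in the same direction along
the edge if the edge is positive and in opposite directions if it is negative. -/
structure Arc (G : SignedGraph V E) where
  edge : E
  arrow : Bool → ℤˣ
  arrow_mul_arrow : arrow false * arrow true = -G.sign edge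

/-- The opposite arc. -/
def Arc.opp {G : SignedGraph V E} (a : G.Arc) : G.Arc where
  edge := a.edge
  arrow := fun i => -a.arrow i
  arrow_mul_arrow := by rw [neg_mul_neg, a.arrow_mul_arrow]

/-- A selected arc on the edge `e`. -/
def arcOf (G : SignedGraph V E) (e : E) : G.Arc where
  edge := e
  arrow := fun i => if i = true then 1 else -G.sign e
  arrow_mul_arrow := by simp

/-- The incidence function `[x, a]`, the sum of the arrows of `a` at `x`: it is `±1` for a non-loop
arc at `x`, `±2` for a negative loop at `x`, and `0` otherwise. -/
def incidence [DecidableEq V] (G : SignedGraph V E) (x : V) (a : G.Arc) : ℤ :=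
  ∑ i : Bool, if G.ends a.edge i = some x then (a.arrow i : ℤ) else 0

/-- The group of `1`-chains of `G` over `A`. -/
def chainGroup (G : SignedGraph V E) (A : Type w) [AddCommGroup A] : AddSubgroup (G.Arc → A) where
  carrier := {c | ∀ a : G.Arc, c a.opp = -c a}
  zero_mem' := by intro a; simp
  add_mem' := by
    intro c d hc hd a
    simp only [Pi.add_apply, hc a, hd a, neg_add]
  neg_mem' := by
    intro c hc a
    simp only [Pi.neg_apply, hc a]

/-- The boundary operator `(∂c)(x) = ∑ e, [x, a_e] c(a_e)`, where `a_e` is an arc on `e`. -/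
def boundary [Fintype E] [DecidableEq V] (G : SignedGraph V E) (A : Type w) [AddCommGroup A] :
    G.chainGroup A →+ (V → A) where
  toFun c x := ∑ e : E, G.incidence x (G.arcOf e) • c.1 (G.arcOf e)
  map_zero' := by ext x; simp
  map_add' := by
    intro c d
    ext x
    simp [smul_add, Finset.sum_add_distrib]

/-- An arc is the selected arc on its edge or the opposite of the selected arc. -/
theorem Arc.eq_or_eq_opp {G : SignedGraph V E} (a : G.Arc) :
    a = G.arcOf a.edge ∨ a = (G.arcOf a.edge).opp := by
  obtain ⟨e, s, h⟩ := a
  rcases Int.units_eq_one_or (s true) with h1 | h1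
  · left
    rw [h1, mul_one] at h
    simp only [arcOf, Arc.mk.injEq, true_and]
    funext i
    cases i <;> simp [h, h1]
  · right
    rw [h1, mul_neg, mul_one, neg_inj] at h
    simp only [arcOf, Arc.opp, Arc.mk.injEq, true_and]
    funext i
    cases i <;> simp [h, h1]

/-- The boundary does not depend on the arcs selected on the edges. -/
theorem boundary_apply [Fintype E] [DecidableEq V] (G : SignedGraph V E) (A : Type w)
    [AddCommGroup A] (c : G.chainGroup A) (x : V) (o : E → G.Arc) (ho : ∀ e, (o e).edge = e) :
    G.boundary A c x = ∑ e : E, G.incidence x (o e) • c.1 (o e) := by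
  refine Finset.sum_congr rfl fun e _ => ?_
  rcases (o e).eq_or_eq_opp with h | h
  · rw [h, ho]
  · rw [h, ho, c.2 (G.arcOf e)]
    have : G.incidence x (G.arcOf e).opp = -G.incidence x (G.arcOf e) := by
      simp only [incidence, Arc.opp, ← Finset.sum_neg_distrib]
      refine Finset.sum_congr rfl fun i _ => ?_
      by_cases hx : G.ends (G.arcOf e).edge i = some x <;> simp [hx]
    rw [this, neg_smul_neg]

/-- The flow group, the kernel of the boundary operator. -/
def flowGroup [Fintype E] [DecidableEq V] (G : SignedGraph V E) (A : Type w) [AddCommGroup A] :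
    AddSubgroup (G.chainGroup A) :=
  (G.boundary A).ker

/-- The set of nowhere-zero flows. -/
def nowhereZeroFlows [Fintype E] [DecidableEq V] (G : SignedGraph V E) (A : Type w)
    [AddCommGroup A] : Set (G.chainGroup A) :=
  {f | f ∈ G.flowGroup A ∧ ∀ a : G.Arc, f.1 a ≠ 0}

/-! ### Circles, balance, numerical invariants of spanning subgraphs -/

/-- The adjacency of vertices in the spanning subgraph `(V, S)`. -/
def adjGraph (G : SignedGraph V E) (S : Finset E) : SimpleGraph V :=
  SimpleGraph.fromRel fun x y => ∃ e ∈ S, G.ends e false = some x ∧ G.ends e true = some y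

/-- The components of the spanning subgraph `(V, S)`; an isolated vertex is a component. -/
abbrev Component (G : SignedGraph V E) (S : Finset E) : Type u :=
  (G.adjGraph S).ConnectedComponent

/-- The degree of `x` in `(V, S)`: the number of edge ends at `x` (a loop counts twice). -/
noncomputable def degree (G : SignedGraph V E) (S : Finset E) (x : V) : ℕ :=
  {p : E × Bool | p.1 ∈ S ∧ G.ends p.1 p.2 = some x}.ncard

/-- `C` is the edge set of a circle: a connected 2-regular subgraph without outer-edges. -/
def IsCircle (G : SignedGraph V E) (C : Finset E) : Prop :=
  C.Nonempty ∧ (∀ e ∈ C, ¬ G.IsOuterEdge e) ∧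
  (∀ e ∈ C, ∀ x, G.IsEndpoint e x → G.degree C x = 2) ∧
  (∀ e ∈ C, ∀ e' ∈ C, ∀ x y, G.IsEndpoint e x → G.IsEndpoint e' y → (G.adjGraph C).Reachable x y)

/-- The edges of the component `K` of `(V, S)`, outer-edges included. -/
def componentEdges (G : SignedGraph V E) (S : Finset E) (K : G.Component S) : Set E :=
  {e | e ∈ S ∧ ∃ x, G.IsEndpoint e x ∧ (G.adjGraph S).connectedComponentMk x = K}

/-- The component `K` of `(V, S)` is compact: it contains no outer-edges. -/
def IsCompactComponent (G : SignedGraph V E) (S : Finset E) (K : G.Component S) : Prop :=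
  ∀ e ∈ G.componentEdges S K, ¬ G.IsOuterEdge e

/-- The component `K` of `(V, S)` is balanced: it contains no outer-edges and all its circles are
positive. -/
def IsBalancedComponent (G : SignedGraph V E) (S : Finset E) (K : G.Component S) : Prop :=
  G.IsCompactComponent S K ∧
  ∀ C : Finset E, G.IsCircle C → (C : Set E) ⊆ G.componentEdges S K → ∏ e ∈ C, G.sign e = 1

/-- `c(S)`, the number of components of `(V, S)`. -/
noncomputable def numComponents (G : SignedGraph V E) (S : Finset E) : ℕ :=
  Nat.card (G.Component S)

/-- `b(S)`, the number of balanced components of `(V, S)`. -/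
noncomputable def numBalanced (G : SignedGraph V E) (S : Finset E) : ℕ :=
  Nat.card {K : G.Component S // G.IsBalancedComponent S K}

/-- `u_c(S)`, the number of compact unbalanced components of `(V, S)`. -/
noncomputable def numCompactUnbalanced (G : SignedGraph V E) (S : Finset E) : ℕ :=
  Nat.card {K : G.Component S // G.IsCompactComponent S K ∧ ¬ G.IsBalancedComponent S K}

/-- The rank `r(S) = |V| - b(S)`; here `b(S) ≤ |V|`. -/
noncomputable def rank [Fintype V] (G : SignedGraph V E) (S : Finset E) : ℕ :=
  Fintype.card V - G.numBalanced S

/-- The cycle-rank `cr(S) = |S| - r(S)`; here `r(S) ≤ |S|`, as `r` is the rank function of a matroid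
on `E`. -/
noncomputable def cycleRank [Fintype V] (G : SignedGraph V E) (S : Finset E) : ℕ :=
  S.card - G.rank S

/-- A co-loop: an edge whose removal increases the number of balanced components by exactly one. -/
def IsCoLoop [Fintype E] [DecidableEq E] (G : SignedGraph V E) (e : E) : Prop :=
  G.numBalanced (Finset.univ.erase e) = G.numBalanced Finset.univ + 1

/-- A bridge: an edge whose removal increases the number of components by exactly one. -/
def IsBridge [Fintype E] [DecidableEq E] (G : SignedGraph V E) (e : E) : Prop :=
  G.numComponents (Finset.univ.erase e) = G.numComponents Finset.univ + 1

/-! ### The counting property -/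

/-- The bivariate polynomial `φ(t, x)` (with `t = X 0` and `x = X 1`) counts nowhere-zero flows:
`|F_nz(G, A)| = φ(|Tor₂ A|, |A|)` for all finite abelian groups `A`. -/
def CountsNowhereZeroFlows [Fintype E] [DecidableEq V] {R : Type r} [CommRing R]
    (G : SignedGraph V E) (φ : MvPolynomial (Fin 2) R) : Prop :=
  ∀ (A : Type w) [AddCommGroup A] [Finite A],
    (Nat.card (G.nowhereZeroFlows A) : R) =
      MvPolynomial.eval ![(Nat.card {a : A // 2 • a = 0} : R), (Nat.card A : R)] φ

end SignedGraph

/-! The heart is a count: the flows over a finite group `A` that vanish outside `S` number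
t^{u_c(S)} x^{cr(S)}, with t = |Tor₂ A| and x = |A| (`card_isEdgeFlow`). Comparing kernel and image
of the boundary A^S → A^V, the size of the kernel is |A|^{|S| - |V|} times the number of characters
of A^V that kill the image. Such a character is a potential: a function from V to the dual of A
whose values at the two ends of each edge agree up to the sign of the edge. On a balanced component
a potential is determined by one arbitrary value, after switching to positive signs; on a compact
unbalanced one a negative circle forces that value to be 2-torsion; an outer-edge forces it to be 0
(`card_isPotential`). As A and its dual have the same order and the same number of 2-torsion
elements, the count follows.

Inclusion-exclusion over the edges on which a flow vanishes then gives the formula. Uniqueness holds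
because the groups (ℤ/2)^k × ℤ/(2j+1) realise enough pairs (t, x) to determine a polynomial.

For the vanishing criterion, nonzero flows on the individual edges combine into one nowhere-zero
flow over a power of ℤ/6. So φ ≠ 0 as soon as every edge carries a nonzero flow over ℤ/6, and over
this group an edge e carries none exactly when u_c and cr are the same for E and E∖e. In that case
no flow over any finite group lives on e, so φ = 0. A comparison of components shows that these
edges are the co-loops that are bridges or outer-edges. -/

namespace SignedGraph

/-! ### Balance and switching -/

variable {V : Type u} {E : Type v}

/-- `η` switches the edges of `T` having two endpoints to positive edges. -/
def IsSwitching (G : SignedGraph V E) (T : Set E) (η : V → ℤˣ) : Prop :=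
  ∀ e ∈ T, ∀ x y, G.ends e false = some x → G.ends e true = some y → G.sign e = η x * η y

theorem degree_eq_sum [DecidableEq V] (G : SignedGraph V E) (S : Finset E) (x : V) :
    G.degree S x = ∑ e ∈ S, ∑ i : Bool, if G.ends e i = some x then 1 else 0 := by
  classical
  have h : {p : E × Bool | p.1 ∈ S ∧ G.ends p.1 p.2 = some x} =
      ((S ×ˢ (Finset.univ : Finset Bool)).filter fun p => G.ends p.1 p.2 = some x : Finset _) := by
    ext p; simp
  rw [degree, h, Set.ncard_coe_finset, Finset.card_filter, Finset.sum_product]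

theorem degree_insert [DecidableEq V] [DecidableEq E] (G : SignedGraph V E) {S : Finset E} {e : E}
    (he : e ∉ S) {x y : V} (hx : G.ends e false = some x) (hy : G.ends e true = some y) (z : V) :
    G.degree (insert e S) z =
      G.degree S z + (if z = x then 1 else 0) + (if z = y then 1 else 0) := by
  simp only [degree_eq_sum, Finset.sum_insert he, Fintype.sum_bool, hx, hy, Option.some.injEq,
    eq_comm (a := z)]
  ring

theorem degree_eq_zero (G : SignedGraph V E) {S : Finset E} {x : V}
    (h : ∀ e ∈ S, ¬ G.IsEndpoint e x) : G.degree S x = 0 := by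
  have : {p : E × Bool | p.1 ∈ S ∧ G.ends p.1 p.2 = some x} = ∅ := by
    ext p
    simp only [Set.mem_ofPred_eq, Set.mem_empty_iff_false, iff_false, not_and]
    exact fun hp hx => h _ hp ⟨_, hx⟩
  rw [degree, this, Set.ncard_empty]

theorem adjGraph_mono (G : SignedGraph V E) {S T : Finset E} (h : S ⊆ T) :
    G.adjGraph S ≤ G.adjGraph T := by
  intro x y
  simp only [adjGraph, SimpleGraph.fromRel_adj]
  rintro ⟨hne, ⟨e, he, h1⟩ | ⟨e, he, h1⟩⟩
  · exact ⟨hne, Or.inl ⟨e, h he, h1⟩⟩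
  · exact ⟨hne, Or.inr ⟨e, h he, h1⟩⟩

theorem reachable_of_ends (G : SignedGraph V E) {S : Finset E} {e : E} (he : e ∈ S) {x y : V}
    (hx : G.ends e false = some x) (hy : G.ends e true = some y) :
    (G.adjGraph S).Reachable x y := by
  by_cases h : x = y
  · subst h; rfl
  · exact SimpleGraph.Adj.reachable ⟨h, Or.inl ⟨e, he, hx, hy⟩⟩

theorem reachable_of_isEndpoint (G : SignedGraph V E) {S : Finset E} {e : E} (he : e ∈ S) {x y : V}
    (hx : G.IsEndpoint e x) (hy : G.IsEndpoint e y) : (G.adjGraph S).Reachable x y := by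
  obtain ⟨i, hi⟩ := hx
  obtain ⟨j, hj⟩ := hy
  cases i <;> cases j
  · rw [hi] at hj; cases hj; rfl
  · exact G.reachable_of_ends he hi hj
  · exact (G.reachable_of_ends he hj hi).symm
  · rw [hi] at hj; cases hj; rfl

theorem exists_ends_of_not_isOuterEdge (G : SignedGraph V E) {e : E} (h : ¬ G.IsOuterEdge e) :
    ∃ x y, G.ends e false = some x ∧ G.ends e true = some y := by
  simp only [IsOuterEdge, not_exists] at h
  obtain ⟨x, hx⟩ := Option.ne_none_iff_exists'.1 (h false)
  obtain ⟨y, hy⟩ := Option.ne_none_iff_exists'.1 (h true)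
  exact ⟨x, y, hx, hy⟩

theorem not_isOuterEdge_of_ends (G : SignedGraph V E) {e : E} {x y : V}
    (hx : G.ends e false = some x) (hy : G.ends e true = some y) : ¬ G.IsOuterEdge e := by
  rintro ⟨i, hi⟩
  cases i <;> simp_all

theorem eq_or_eq_of_isEndpoint (G : SignedGraph V E) {e : E} {x y z : V}
    (hx : G.ends e false = some x) (hy : G.ends e true = some y) (hz : G.IsEndpoint e z) :
    z = x ∨ z = y := by
  obtain ⟨i, hi⟩ := hz
  cases i <;> simp_all

/-- A path of the underlying simple graph lifts to a set of edges. -/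
theorem exists_edges_of_isPath [DecidableEq V] (G : SignedGraph V E) {S : Finset E}
    {η : V → ℤˣ} (hη : G.IsSwitching S η) {x y : V} (p : (G.adjGraph S).Walk x y) (hp : p.IsPath) :
    ∃ P ⊆ S, (∀ e ∈ P, ¬ G.IsOuterEdge e) ∧ (∀ e ∈ P, ∀ z, G.IsEndpoint e z → z ∈ p.support) ∧
      (∀ z ∈ p.support,
        G.degree P z + (if z = x then 1 else 0) + (if z = y then 1 else 0) = 2) ∧
      (∀ z ∈ p.support, (G.adjGraph P).Reachable x z) ∧ ∏ e ∈ P, G.sign e = η x * η y := by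
  classical
  induction p with
  | nil =>
    refine ⟨∅, by simp, by simp, by simp, ?_, ?_, by simp [Int.units_mul_self]⟩
    · intro z hz
      simp only [SimpleGraph.Walk.support_nil, List.mem_singleton] at hz
      simp [hz, degree_eq_zero]
    · intro z hz
      simp only [SimpleGraph.Walk.support_nil, List.mem_singleton] at hz
      rw [hz]
  | @cons x z y hadj p ih =>
    rw [SimpleGraph.Walk.cons_isPath_iff] at hp
    obtain ⟨P, hPS, hout, hsupp, hdeg, hreach, hprod⟩ := ih hp.1
    have key : ∃ e ∈ S, ¬ G.IsOuterEdge e ∧ (∀ w, G.IsEndpoint e w ↔ w = x ∨ w = z) ∧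
        G.sign e = η x * η z ∧ ∀ T : Finset E, e ∉ T → ∀ w, G.degree (insert e T) w =
          G.degree T w + (if w = x then 1 else 0) + (if w = z then 1 else 0) := by
      obtain ⟨-, ⟨e, he, h1, h2⟩ | ⟨e, he, h1, h2⟩⟩ := hadj
      · refine ⟨e, he, G.not_isOuterEdge_of_ends h1 h2, fun w => ⟨G.eq_or_eq_of_isEndpoint h1 h2, ?_⟩,
          hη e he _ _ h1 h2, fun T hT w => G.degree_insert hT h1 h2 w⟩
        rintro (rfl | rfl)
        exacts [⟨_, h1⟩, ⟨_, h2⟩]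
      · refine ⟨e, he, G.not_isOuterEdge_of_ends h1 h2,
          fun w => ⟨fun h => (G.eq_or_eq_of_isEndpoint h1 h2 h).symm, ?_⟩,
          by rw [hη e he _ _ h1 h2, mul_comm], fun T hT w => ?_⟩
        · rintro (rfl | rfl)
          exacts [⟨_, h2⟩, ⟨_, h1⟩]
        · rw [G.degree_insert hT h1 h2 w]; ring
    obtain ⟨e, heS, heout, hends, hsign, hdegi⟩ := key
    have heP : e ∉ P := fun h => hp.2 (hsupp e h x ((hends x).2 (Or.inl rfl)))
    refine ⟨insert e P, Finset.insert_subset heS hPS, ?_, ?_, ?_, ?_, ?_⟩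
    · intro e' he'
      rcases Finset.mem_insert.1 he' with rfl | h
      exacts [heout, hout _ h]
    · intro e' he' w hw
      rw [SimpleGraph.Walk.support_cons, List.mem_cons]
      rcases Finset.mem_insert.1 he' with rfl | h
      · rcases (hends w).1 hw with rfl | rfl
        exacts [Or.inl rfl, Or.inr p.start_mem_support]
      · exact Or.inr (hsupp _ h w hw)
    · intro w hw
      rw [hdegi P heP]
      rw [SimpleGraph.Walk.support_cons, List.mem_cons] at hw
      have hxz : x ≠ z := fun h => hp.2 (h ▸ p.start_mem_support)
      have hxy : x ≠ y := fun h => hp.2 (h ▸ p.end_mem_support)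
      rcases hw with rfl | hw
      · rw [G.degree_eq_zero fun e' he' h => hp.2 (hsupp e' he' _ h)]
        simp [hxz, hxy]
      · have hwx : w ≠ x := fun h => hp.2 (h ▸ hw)
        simpa [hwx] using hdeg w hw
    · have hxz : (G.adjGraph (insert e P)).Reachable x z :=
        G.reachable_of_isEndpoint (Finset.mem_insert_self e P) ((hends x).2 (Or.inl rfl))
          ((hends z).2 (Or.inr rfl))
      intro w hw
      rw [SimpleGraph.Walk.support_cons, List.mem_cons] at hw
      rcases hw with rfl | hw
      · rfl
      · exact hxz.trans ((hreach w hw).mono (G.adjGraph_mono (Finset.subset_insert e P)))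
    · rw [Finset.prod_insert heP, hprod, hsign, mul_assoc, ← mul_assoc (η z), Int.units_mul_self,
        one_mul]

/-- Edges all of whose circles are positive can be switched to positive edges. -/
theorem exists_isSwitching (G : SignedGraph V E) (S : Finset E)
    (h : ∀ C : Finset E, G.IsCircle C → C ⊆ S → ∏ e ∈ C, G.sign e = 1) :
    ∃ η, G.IsSwitching S η := by
  classical
  induction S using Finset.induction_on with
  | empty => exact ⟨1, by intro e he; simp at he⟩
  | insert e S he ih =>
    obtain ⟨η, hη⟩ := ih fun C hC hCS => h C hC (hCS.trans (Finset.subset_insert e S))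
    by_cases hout : G.IsOuterEdge e
    · refine ⟨η, fun e' he' x y hx hy => ?_⟩
      rcases Finset.mem_insert.1 (Finset.mem_coe.1 he') with rfl | h'
      · exact absurd hout (G.not_isOuterEdge_of_ends hx hy)
      · exact hη e' h' x y hx hy
    obtain ⟨x, y, hx, hy⟩ := G.exists_ends_of_not_isOuterEdge hout
    by_cases hr : (G.adjGraph S).Reachable x y
    · have hsign : G.sign e = η x * η y := by
        obtain ⟨q⟩ := hr
        obtain ⟨P, hPS, hPout, hsupp, hdeg, hreach, hprod⟩ :=
          G.exists_edges_of_isPath hη q.toPath.1 q.toPath.2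
        have heP : e ∉ P := fun h' => he (hPS h')
        have hmem : ∀ e' ∈ insert e P, ∀ z, G.IsEndpoint e' z → z ∈ q.toPath.1.support := by
          intro e' he' z hz
          rcases Finset.mem_insert.1 he' with rfl | h'
          · rcases G.eq_or_eq_of_isEndpoint hx hy hz with rfl | rfl
            exacts [SimpleGraph.Walk.start_mem_support _, SimpleGraph.Walk.end_mem_support _]
          · exact hsupp e' h' z hz
        have hre : ∀ z ∈ q.toPath.1.support, (G.adjGraph (insert e P)).Reachable x z :=
          fun z hz => (hreach z hz).mono (G.adjGraph_mono (Finset.subset_insert e P))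
        -- The new edge adds one to the degree at `x` and one at `y` (two if `x = y`), exactly what
        -- `hdeg` says is missing from degree 2; loops and parallel edges need no separate case.
        have hcirc : G.IsCircle (insert e P) := by
          refine ⟨Finset.insert_nonempty e P, ?_, ?_, ?_⟩
          · intro e' he'
            rcases Finset.mem_insert.1 he' with rfl | h'
            exacts [hout, hPout e' h']
          · intro e' he' z hz
            rw [G.degree_insert heP hx hy]
            exact hdeg z (hmem e' he' z hz)
          · intro e' he' e'' he'' z z' hz hz'
            exact (hre z (hmem e' he' z hz)).symm.trans (hre z' (hmem e'' he'' z' hz'))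
        have := h _ hcirc (Finset.insert_subset_insert e hPS)
        rw [Finset.prod_insert heP, hprod] at this
        rw [eq_inv_of_mul_eq_one_left this, Int.units_inv_eq_self]
      refine ⟨η, fun e' he' x' y' hx' hy' => ?_⟩
      rcases Finset.mem_insert.1 (Finset.mem_coe.1 he') with rfl | h'
      · rw [hx] at hx'; rw [hy] at hy'; cases hx'; cases hy'; exact hsign
      · exact hη e' h' x' y' hx' hy'
    -- The ends of `e` lie in different components of `(V, S)`, so `η` may be multiplied by a
    -- constant on the component of `x`. This `s` makes `e` fit, and it cancels on every edge of
    -- `S`, since both ends of such an edge are multiplied or neither is.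
    · let s : ℤˣ := G.sign e * η x * η y
      refine ⟨fun z => if (G.adjGraph S).Reachable x z then s * η z else η z,
        fun e' he' x' y' hx' hy' => ?_⟩
      rcases Finset.mem_insert.1 (Finset.mem_coe.1 he') with rfl | h'
      · rw [hx] at hx'; rw [hy] at hy'; cases hx'; cases hy'
        simp only [SimpleGraph.Reachable.refl, if_true, hr, if_false, s]
        rcases Int.units_eq_one_or (η x) with h1 | h1 <;>
          rcases Int.units_eq_one_or (η y) with h2 | h2 <;> simp [h1, h2]
      · have hiff : (G.adjGraph S).Reachable x x' ↔ (G.adjGraph S).Reachable x y' :=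
          ⟨fun h1 => h1.trans (G.reachable_of_ends h' hx' hy'),
            fun h1 => h1.trans (G.reachable_of_ends h' hx' hy').symm⟩
        rw [hη e' h' x' y' hx' hy']
        by_cases h1 : (G.adjGraph S).Reachable x y'
        · simp only [hiff, h1, if_true]
          rw [mul_mul_mul_comm, Int.units_mul_self, one_mul]
        · simp only [hiff, h1, if_false]

/-- The circles consisting of switchable edges are positive. -/
theorem IsCircle.prod_sign_eq_one [Fintype V] {G : SignedGraph V E} {C : Finset E}
    (hC : G.IsCircle C) {η : V → ℤˣ} (hη : G.IsSwitching C η) : ∏ e ∈ C, G.sign e = 1 := by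
  classical
  have h1 : ∀ e ∈ C, G.sign e =
      ∏ z : V, η z ^ (∑ i : Bool, if G.ends e i = some z then 1 else 0) := by
    intro e he
    obtain ⟨x, y, hx, hy⟩ := G.exists_ends_of_not_isOuterEdge (hC.2.1 e he)
    rw [hη e he x y hx hy]
    simp only [Fintype.sum_bool, hx, hy, pow_add, Finset.prod_mul_distrib, Option.some.injEq,
      pow_ite, pow_one, pow_zero, Finset.prod_ite_eq, Finset.mem_univ, if_true]
    rw [mul_comm]
  rw [Finset.prod_congr rfl h1, Finset.prod_comm]
  refine Finset.prod_eq_one fun z _ => ?_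
  -- The exponent of `η z` in the product over all edges is the degree of `z` in the circle, which
  -- is 2 or 0.
  rw [Finset.prod_pow_eq_pow_sum, ← degree_eq_sum]
  by_cases hz : ∃ e ∈ C, G.IsEndpoint e z
  · obtain ⟨e, he, hz⟩ := hz
    rw [hC.2.2.1 e he z hz, Int.units_sq]
  · push Not at hz
    rw [G.degree_eq_zero hz, pow_zero]

/-- Harary's criterion, applied to one component: it replaces the condition on circles by a sign
function on vertices, with which potentials can be built. -/
theorem isBalancedComponent_iff [Fintype V] [Finite E] (G : SignedGraph V E) {S : Finset E}
    (K : G.Component S) : G.IsBalancedComponent S K ↔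
      G.IsCompactComponent S K ∧ ∃ η, G.IsSwitching (G.componentEdges S K) η := by
  refine and_congr_right fun _ => ⟨fun h => ?_, ?_⟩
  · have := G.exists_isSwitching (Set.toFinite (G.componentEdges S K)).toFinset
      fun C hC hCS => h C hC fun e he => by simpa using hCS he
    simpa using this
  · rintro ⟨η, hη⟩ C hC hCK
    exact hC.prod_sign_eq_one fun e he => hη e (hCK he)

end SignedGraph

/-! ### Counting potentials -/

namespace SignedGraph

variable {V : Type u} {E : Type v}

/-- The potentials `g : V → B` compatible with the edges of `S`: the values at the two ends of an
edge agree up to the sign of the edge, the value at an end without vertex being `0`. -/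
def IsPotential (G : SignedGraph V E) (S : Finset E) {B : Type w} [AddCommGroup B] (g : V → B) :
    Prop :=
  ∀ e ∈ S, (G.ends e true).elim 0 g = (G.sign e : ℤ) • (G.ends e false).elim 0 g

theorem iff_of_reachable (G : SignedGraph V E) {S : Finset E} {p : V → Prop} {x y : V}
    (hr : (G.adjGraph S).Reachable x y)
    (h : ∀ e ∈ S, ∀ a b, G.ends e false = some a → G.ends e true = some b → (p a ↔ p b)) :
    p x ↔ p y := by
  obtain ⟨q⟩ := hr
  induction q with
  | nil => rfl
  | @cons x z y hadj q ih =>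
    have h1 : p x ↔ p z := by
      obtain ⟨-, ⟨e, he, h1, h2⟩ | ⟨e, he, h1, h2⟩⟩ := hadj
      · exact h e he _ _ h1 h2
      · exact (h e he _ _ h1 h2).symm
    exact h1.trans ih

theorem IsPotential.eq_smul {G : SignedGraph V E} {S : Finset E} {B : Type w} [AddCommGroup B]
    {g : V → B} (hg : G.IsPotential S g) {e : E} (he : e ∈ S) {x y : V}
    (hx : G.ends e false = some x) (hy : G.ends e true = some y) :
    g y = (G.sign e : ℤ) • g x := by
  simpa [hx, hy] using hg e he

/-- Signs are invertible, so agreement of two potentials passes along an edge both ways; a potential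
is thus determined by one value per component. -/
theorem IsPotential.eq_iff_eq {G : SignedGraph V E} {S : Finset E} {B : Type w} [AddCommGroup B]
    {g g' : V → B} (hg : G.IsPotential S g) (hg' : G.IsPotential S g') {x y : V}
    (hr : (G.adjGraph S).Reachable x y) : g x = g' x ↔ g y = g' y := by
  refine G.iff_of_reachable (p := fun z => g z = g' z) hr fun e he a b ha hb => ?_
  rw [hg.eq_smul he ha hb, hg'.eq_smul he ha hb]
  rcases Int.units_eq_one_or (G.sign e) with h | h <;> simp [h]

theorem isPotential_zero (G : SignedGraph V E) (S : Finset E) (B : Type w) [AddCommGroup B] :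
    G.IsPotential S (0 : V → B) := by
  intro e _
  cases G.ends e true <;> cases G.ends e false <;> simp

theorem IsPotential.eq_or_eq_neg {G : SignedGraph V E} {S : Finset E} {B : Type w}
    [AddCommGroup B] {g : V → B} (hg : G.IsPotential S g) {x y : V}
    (hr : (G.adjGraph S).Reachable x y) : g y = g x ∨ g y = -g x := by
  refine (G.iff_of_reachable (p := fun z => g z = g x ∨ g z = -g x) hr
    fun e he a b ha hb => ?_).1 (Or.inl rfl)
  rw [hg.eq_smul he ha hb]
  rcases Int.units_eq_one_or (G.sign e) with h | h
  · simp [h]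
  · simp [h, neg_eq_iff_eq_neg, or_comm]

/-- At an outer-edge one side of the defining equation is 0, so the potential vanishes at the vertex
of that edge; comparison with the zero potential spreads this over the component. -/
theorem IsPotential.eq_zero {G : SignedGraph V E} {S : Finset E} {B : Type w}
    [AddCommGroup B] {g : V → B} (hg : G.IsPotential S g) {K : G.Component S}
    (hK : ¬ G.IsCompactComponent S K) {x : V} (hx : (G.adjGraph S).connectedComponentMk x = K) :
    g x = 0 := by
  simp only [IsCompactComponent, not_forall, not_not] at hK
  obtain ⟨e, ⟨he, z, ⟨i, hz⟩, hzK⟩, ⟨j, hj⟩⟩ := hK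
  have hr : (G.adjGraph S).Reachable z x :=
    SimpleGraph.ConnectedComponent.exact (hzK.trans hx.symm)
  refine (hg.eq_iff_eq (G.isPotential_zero S B) hr).1 ?_
  have := hg e he
  cases i <;> cases j <;> simp_all
  rcases Int.units_eq_one_or (G.sign e) with h | h <;> simp_all

/-- On a component the values are `g r` or `-g r`. If these differ, recording which of the two
occurs is a switching function, and the component would be balanced. -/
theorem IsPotential.two_nsmul_eq_zero [Fintype V] [Finite E] {G : SignedGraph V E} {S : Finset E}
    {B : Type w} [AddCommGroup B] {g : V → B} (hg : G.IsPotential S g) {K : G.Component S}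
    (hK : G.IsCompactComponent S K) (hK' : ¬ G.IsBalancedComponent S K) {r : V}
    (hr : (G.adjGraph S).connectedComponentMk r = K) : 2 • g r = 0 := by
  classical
  by_contra h2
  have hne : g r ≠ -g r := fun h => h2 (by rw [two_nsmul]; nth_rw 2 [h]; simp)
  refine hK' ((G.isBalancedComponent_iff K).2 ⟨hK, fun z => if g z = g r then 1 else -1, ?_⟩)
  rintro e ⟨he, z, hz, hzK⟩ x y hx hy
  have hrz : (G.adjGraph S).Reachable r z :=
    SimpleGraph.ConnectedComponent.exact (hr.trans hzK.symm)
  have h1 := hg.eq_or_eq_neg (hrz.trans (G.reachable_of_isEndpoint he hz ⟨_, hx⟩))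
  have h3 := hg.eq_smul he hx hy
  rcases Int.units_eq_one_or (G.sign e) with h | h <;> rcases h1 with h1 | h1 <;>
    simp_all [hne.symm]

theorem exists_isPotential [Fintype V] [Finite E] (G : SignedGraph V E) (S : Finset E)
    {B : Type w} [AddCommGroup B] (β : G.Component S → B)
    (h0 : ∀ K, ¬ G.IsCompactComponent S K → β K = 0)
    (h2 : ∀ K, G.IsCompactComponent S K → ¬ G.IsBalancedComponent S K → 2 • β K = 0)
    (r : G.Component S → V) :
    ∃ g : V → B, G.IsPotential S g ∧
      ∀ K, (G.adjGraph S).connectedComponentMk (r K) = K → g (r K) = β K := by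
  classical
  have hη : ∀ K, ∃ η : V → ℤˣ, G.IsBalancedComponent S K → G.IsSwitching (G.componentEdges S K) η := by
    intro K
    by_cases hK : G.IsBalancedComponent S K
    · obtain ⟨η, hη⟩ := ((G.isBalancedComponent_iff K).1 hK).2
      exact ⟨η, fun _ => hη⟩
    · exact ⟨1, fun h => absurd h hK⟩
  choose η hη using hη
  -- On a balanced component the value at the representative is transported by the switching signs.
  -- On the others `β K = -β K`, so the signs are irrelevant.
  refine ⟨fun z => ((η ((G.adjGraph S).connectedComponentMk z) z *
    η ((G.adjGraph S).connectedComponentMk z) (r ((G.adjGraph S).connectedComponentMk z)) : ℤˣ) : ℤ)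
      • β ((G.adjGraph S).connectedComponentMk z), ?_, ?_⟩
  · intro e he
    by_cases hout : G.IsOuterEdge e
    · have h1 : ∀ i z, G.ends e i = some z → β ((G.adjGraph S).connectedComponentMk z) = 0 :=
        fun i z hz => h0 _ fun hc => hc e ⟨he, z, ⟨i, hz⟩, rfl⟩ hout
      have h3 : ∀ (f : V → ℤ) i, (G.ends e i).elim 0
          (fun z => f z • β ((G.adjGraph S).connectedComponentMk z)) = 0 := by
        intro f i
        cases hi : G.ends e i with
        | none => rfl
        | some z => simp [h1 i z hi]
      rw [h3, h3, smul_zero]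
    · obtain ⟨x, y, hx, hy⟩ := G.exists_ends_of_not_isOuterEdge hout
      have hxy : (G.adjGraph S).connectedComponentMk y = (G.adjGraph S).connectedComponentMk x :=
        SimpleGraph.ConnectedComponent.sound (G.reachable_of_ends he hx hy).symm
      simp only [hx, hy, Option.elim_some, hxy]
      set K := (G.adjGraph S).connectedComponentMk x with hK
      by_cases hb : G.IsBalancedComponent S K
      · rw [hη K hb e ⟨he, x, ⟨_, hx⟩, rfl⟩ x y hx hy, smul_smul, ← Units.val_mul]
        congr 2
        rw [mul_mul_mul_comm, Int.units_mul_self, one_mul, mul_comm]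
      · have hneg : -β K = β K := by
          by_cases hc : G.IsCompactComponent S K
          · rw [neg_eq_iff_add_eq_zero, ← two_nsmul, h2 K hc hb]
          · rw [h0 K hc, neg_zero]
        have hu : ∀ s : ℤˣ, (s : ℤ) • β K = β K := by
          intro s
          rcases Int.units_eq_one_or s with h | h <;> simp [h, hneg]
        rw [hu, hu, hu]
  · intro K hK
    simp [hK, Int.units_mul_self]

/-- The number of potentials with values in `B` is `|B| ^ b(S) * |Tor₂ B| ^ u_c(S)`. -/
theorem card_isPotential [Fintype V] [Finite E] (G : SignedGraph V E) (S : Finset E)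
    (B : Type w) [AddCommGroup B] :
    Nat.card {g : V → B // G.IsPotential S g} =
      Nat.card B ^ G.numBalanced S *
        Nat.card {b : B // 2 • b = 0} ^ G.numCompactUnbalanced S := by
  classical
  let β : G.Component S → Type w := fun K => {b : B // (¬ G.IsCompactComponent S K → b = 0) ∧
    (G.IsCompactComponent S K → ¬ G.IsBalancedComponent S K → 2 • b = 0)}
  have hout : ∀ K : G.Component S, (G.adjGraph S).connectedComponentMk (Quot.out K) = K :=
    fun K => Quot.out_eq K
  let F : {g : V → B // G.IsPotential S g} → ∀ K, β K := fun g K =>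
    ⟨g.1 (Quot.out K), fun hK => g.2.eq_zero hK (hout K),
      fun hK hK' => g.2.two_nsmul_eq_zero hK hK' (hout K)⟩
  have hF : Function.Bijective F := by
    constructor
    · rintro ⟨g, hg⟩ ⟨g', hg'⟩ h
      refine Subtype.ext (funext fun z => ?_)
      have h1 := congrArg Subtype.val (congrFun h ((G.adjGraph S).connectedComponentMk z))
      exact (hg.eq_iff_eq hg' (SimpleGraph.ConnectedComponent.exact
        (hout ((G.adjGraph S).connectedComponentMk z)))).1 h1
    · intro b
      obtain ⟨g, hg, h⟩ := G.exists_isPotential S (fun K => (b K).1) (fun K => (b K).2.1)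
        (fun K => (b K).2.2) Quot.out
      exact ⟨⟨g, hg⟩, funext fun K => Subtype.ext (h K (hout K))⟩
  -- The value at the representative is free on a balanced component, 2-torsion on a compact
  -- unbalanced one, and 0 on a non-compact one.
  have hβ : ∀ K, Nat.card (β K) = (if G.IsBalancedComponent S K then Nat.card B else 1) *
      (if G.IsCompactComponent S K ∧ ¬ G.IsBalancedComponent S K then
        Nat.card {b : B // 2 • b = 0} else 1) := by
    intro K
    by_cases hc : G.IsCompactComponent S K
    · by_cases hb : G.IsBalancedComponent S K
      · simp [β, hc, hb]
      · simp [β, hc, hb]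
    · have hb : ¬ G.IsBalancedComponent S K := fun h => hc h.1
      simp only [β, hc, hb]
      simp
  have : Fintype (G.Component S) := Fintype.ofFinite _
  have hsub : ∀ p : G.Component S → Prop, Nat.card {K // p K} = (Finset.univ.filter p).card :=
    fun p => by rw [Nat.card_eq_fintype_card, Fintype.card_subtype]
  rw [Nat.card_eq_of_bijective F hF, Nat.card_pi, numBalanced, numCompactUnbalanced, hsub, hsub]
  simp only [hβ, Finset.prod_mul_distrib, Finset.prod_ite, Finset.prod_const, one_pow, mul_one]
  congr!

end SignedGraph

/-! ### Duality of finite abelian groups -/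

section Duality

theorem card_addMonoidHom_units_complex (A : Type*) [AddCommGroup A] [Finite A] :
    Nat.card (A →+ Additive ℂˣ) = Nat.card A := by
  rw [Nat.card_congr AddMonoidHom.toMultiplicativeLeft,
    CommGroup.card_monoidHom_of_hasEnoughRootsOfUnity (Multiplicative A) ℂ]
  rfl

theorem AddMonoidHom.card_ker_mul_card_range {A B : Type*} [AddCommGroup A] [AddCommGroup B]
    (f : A →+ B) : Nat.card f.ker * Nat.card f.range = Nat.card A := by
  rw [← AddSubgroup.index_ker, AddSubgroup.card_mul_index]

/-- The characters that vanish on the range of `f`, and the range of `f`. -/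
theorem AddMonoidHom.card_annihilator_mul_card_range {A B : Type*} [AddCommGroup A]
    [AddCommGroup B] [Finite B] (f : A →+ B) :
    Nat.card {χ : B →+ Additive ℂˣ // ∀ a, χ (f a) = 0} * Nat.card f.range = Nat.card B := by
  -- Characters killing the range are the characters of the quotient, and these are as many as its
  -- elements.
  let F : {χ : B →+ Additive ℂˣ // ∀ a, χ (f a) = 0} ≃ (B ⧸ f.range →+ Additive ℂˣ) :=
    { toFun := fun χ => QuotientAddGroup.lift f.range χ.1 (by
        rintro _ ⟨a, rfl⟩
        exact χ.2 a)
      invFun := fun ψ => ⟨ψ.comp (QuotientAddGroup.mk' f.range), fun a => by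
        have : (QuotientAddGroup.mk' f.range) (f a) = 0 :=
          (QuotientAddGroup.eq_zero_iff _).2 ⟨a, rfl⟩
        rw [AddMonoidHom.comp_apply, this, map_zero]⟩
      left_inv := fun χ => by
        ext b
        rfl
      right_inv := fun ψ => by
        ext b
        rfl }
  rw [Nat.card_congr F, card_addMonoidHom_units_complex,
    ← AddSubgroup.card_eq_card_quotient_mul_card_addSubgroup]

/-- A character of order dividing 2 is one that kills 2A; the number of these is the index of 2A,
which is also the size of the kernel of doubling. -/
theorem card_two_torsion_dual (A : Type*) [AddCommGroup A] [Finite A] :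
    Nat.card {χ : A →+ Additive ℂˣ // 2 • χ = 0} = Nat.card {a : A // 2 • a = 0} := by
  let f : A →+ A := nsmulAddMonoidHom 2
  have h1 := f.card_annihilator_mul_card_range
  have h2 := f.card_ker_mul_card_range
  have h3 : Nat.card {χ : A →+ Additive ℂˣ // 2 • χ = 0} =
      Nat.card {χ : A →+ Additive ℂˣ // ∀ a, χ (f a) = 0} := by
    refine Nat.card_congr (Equiv.subtypeEquivRight fun χ => ?_)
    rw [DFunLike.ext_iff]
    simp [f]
  have h4 : Nat.card {a : A // 2 • a = 0} = Nat.card f.ker := rfl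
  rw [h3, h4]
  exact Nat.eq_of_mul_eq_mul_right Nat.card_pos (h1.trans h2.symm)

end Duality

/-! ### Flows on an edge set, counted by duality -/

namespace SignedGraph

variable {V : Type u} {E : Type v}

/-- The boundary operator on functions on an edge set `S`. -/
def edgeBoundary [DecidableEq V] (G : SignedGraph V E) (S : Finset E) (A : Type w)
    [AddCommGroup A] : (S → A) →+ (V → A) where
  toFun f x := ∑ e : S, G.incidence x (G.arcOf e) • f e
  map_zero' := by ext x; simp
  map_add' f g := by
    ext x
    simp [smul_add, Finset.sum_add_distrib]

/-- The transpose of the boundary. The selected arc has arrow 1 at the end `true` and minus the sign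
at the end `false`, so its vanishing on `S` is the potential condition. -/
theorem sum_incidence_smul [Fintype V] [DecidableEq V] (G : SignedGraph V E) (e : E)
    {B : Type w} [AddCommGroup B] (g : V → B) :
    ∑ x, G.incidence x (G.arcOf e) • g x =
      (G.ends e true).elim 0 g - (G.sign e : ℤ) • (G.ends e false).elim 0 g := by
  have h : ∀ (i : Bool) (n : ℤ), ∑ x, (if G.ends e i = some x then n else 0) • g x =
      n • (G.ends e i).elim 0 g := by
    intro i n
    cases hi : G.ends e i with
    | none => simp
    | some z => simp only [Option.some.injEq, ite_smul, zero_smul, Finset.sum_ite_eq,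
        Finset.mem_univ, if_true, Option.elim_some]
  have hinc : ∀ x, G.incidence x (G.arcOf e) = (if G.ends e true = some x then 1 else 0) +
      (if G.ends e false = some x then -(G.sign e : ℤ) else 0) := by
    intro x
    rw [incidence, Fintype.sum_bool]
    rfl
  simp only [hinc, add_smul, Finset.sum_add_distrib, h]
  rw [neg_smul, one_smul, sub_eq_add_neg]

theorem isPotential_iff [Fintype V] [DecidableEq V] (G : SignedGraph V E) (S : Finset E)
    {B : Type w} [AddCommGroup B] (g : V → B) :
    G.IsPotential S g ↔ ∀ e ∈ S, ∑ x, G.incidence x (G.arcOf e) • g x = 0 := by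
  simp only [sum_incidence_smul, sub_eq_zero]
  rfl

/-- The homomorphisms on `V → A` that vanish on the boundaries are the potentials with values in
`A →+ M`. -/
theorem card_annihilator_edgeBoundary [Fintype V] [DecidableEq V] (G : SignedGraph V E)
    (S : Finset E) (A : Type w) [AddCommGroup A] (M : Type r) [AddCommGroup M] :
    Nat.card {χ : (V → A) →+ M // ∀ f, χ (G.edgeBoundary S A f) = 0} =
      Nat.card {g : V → (A →+ M) // G.IsPotential S g} := by
  classical
  let F : ((V → A) →+ M) ≃ (V → (A →+ M)) :=
    { toFun := fun χ x => χ.comp (AddMonoidHom.single (fun _ => A) x)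
      invFun := fun g => ∑ x, (g x).comp (Pi.evalAddMonoidHom (fun _ => A) x)
      left_inv := fun χ => by
        ext x a
        simp [AddMonoidHom.finsetSum_apply, Pi.single_apply, apply_ite]
      right_inv := fun g => by
        ext x a
        simp [AddMonoidHom.finsetSum_apply, Pi.single_apply, apply_ite] }
  have hF : ∀ χ h, χ h = ∑ x, F χ x (h x) := by
    intro χ h
    conv_lhs => rw [← F.symm_apply_apply χ]
    simp only [F, Equiv.coe_fn_symm_mk, AddMonoidHom.finsetSum_apply, AddMonoidHom.comp_apply,
      Pi.evalAddMonoidHom_apply, Equiv.coe_fn_mk]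
  refine Nat.card_congr (F.subtypeEquiv fun χ => ?_)
  rw [isPotential_iff]
  have key : ∀ f : S → A, χ (G.edgeBoundary S A f) =
      ∑ e : S, (∑ x, G.incidence x (G.arcOf e) • F χ x) (f e) := by
    intro f
    rw [hF]
    simp only [edgeBoundary, AddMonoidHom.coe_mk, ZeroHom.coe_mk, map_sum, map_zsmul,
      AddMonoidHom.finsetSum_apply, AddMonoidHom.smul_apply]
    exact Finset.sum_comm
  constructor
  · intro h e he
    ext a
    have := h (Pi.single ⟨e, he⟩ a)
    rw [key, Finset.sum_eq_single ⟨e, he⟩] at this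
    · simpa using this
    · intro e' _ hne
      rw [Pi.single_eq_of_ne hne, map_zero]
    · simp
  · intro h f
    rw [key]
    exact Finset.sum_eq_zero fun e _ => by rw [h e e.2, AddMonoidHom.zero_apply]

/-- The range of the boundary has complementary size both to the kernel and to the annihilator;
eliminating it leaves the kernel in terms of the potentials. The factor |A|^{|V|} stays on the left
to avoid subtraction. -/
theorem card_ker_edgeBoundary [Fintype V] [DecidableEq V] [Finite E] (G : SignedGraph V E)
    (S : Finset E) (A : Type w) [AddCommGroup A] [Finite A] :
    Nat.card (G.edgeBoundary S A).ker * Nat.card A ^ Fintype.card V =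
      Nat.card {a : A // 2 • a = 0} ^ G.numCompactUnbalanced S *
        Nat.card A ^ (S.card + G.numBalanced S) := by
  have h1 := (G.edgeBoundary S A).card_annihilator_mul_card_range
  have h2 := (G.edgeBoundary S A).card_ker_mul_card_range
  rw [card_annihilator_edgeBoundary, card_isPotential, card_addMonoidHom_units_complex,
    card_two_torsion_dual] at h1
  have hV : Nat.card (V → A) = Nat.card A ^ Fintype.card V := by
    rw [Nat.card_fun, Nat.card_eq_fintype_card (α := V)]
  have hS : Nat.card (S → A) = Nat.card A ^ S.card := by
    rw [Nat.card_fun, Nat.card_eq_fintype_card (α := S), Fintype.card_coe]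
  rw [hV] at h1
  rw [hS] at h2
  rw [pow_add, ← h1, ← h2]
  ring

theorem numBalanced_le_card [Fintype V] (G : SignedGraph V E) (S : Finset E) :
    G.numBalanced S ≤ Fintype.card V := by
  rw [← Nat.card_eq_fintype_card]
  exact Nat.card_le_card_of_injective
    (fun K : {K : G.Component S // G.IsBalancedComponent S K} => Quot.out K.1)
    fun K K' h => Subtype.ext (by
      rw [← Quot.out_eq K.1, ← Quot.out_eq K'.1]; exact congrArg _ h)

/-- The rank inequality r(S) ≤ |S|, obtained from the flow count itself: over ℤ/3 there is no
2-torsion, so the count compares powers of 3. It makes the truncated subtractions in `cycleRank`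
exact. -/
theorem card_le_card_add_numBalanced [Fintype V] [Finite E] (G : SignedGraph V E) (S : Finset E) :
    Fintype.card V ≤ S.card + G.numBalanced S := by
  classical
  have h := G.card_ker_edgeBoundary S (ZMod 3)
  have h2 : Nat.card {a : ZMod 3 // 2 • a = 0} = 1 := by
    rw [Nat.card_eq_fintype_card]
    decide
  rw [h2, one_pow, one_mul, Nat.card_zmod] at h
  exact (Nat.pow_le_pow_iff_right (by norm_num : 1 < 3)).1
    (h ▸ Nat.le_mul_of_pos_left _ Nat.card_pos)

theorem cycleRank_add_card [Fintype V] [Finite E] (G : SignedGraph V E) (S : Finset E) :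
    G.cycleRank S + Fintype.card V = S.card + G.numBalanced S := by
  have h1 := G.card_le_card_add_numBalanced S
  have h2 := G.numBalanced_le_card S
  unfold cycleRank rank
  omega

/-- The number of flows on the edge set `S`. -/
theorem card_ker_edgeBoundary_eq [Fintype V] [DecidableEq V] [Finite E] (G : SignedGraph V E)
    (S : Finset E) (A : Type w) [AddCommGroup A] [Finite A] :
    Nat.card (G.edgeBoundary S A).ker =
      Nat.card {a : A // 2 • a = 0} ^ G.numCompactUnbalanced S * Nat.card A ^ G.cycleRank S := by
  have h := G.card_ker_edgeBoundary S A
  rw [← cycleRank_add_card, pow_add, ← mul_assoc] at h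
  exact Nat.eq_of_mul_eq_mul_right (pow_pos Nat.card_pos _) h

end SignedGraph

/-! ### Test groups and polynomials determined by their values on them -/

theorem card_two_torsion_congr {A B : Type*} [AddCommGroup A] [AddCommGroup B] (e : A ≃+ B) :
    Nat.card {a : A // 2 • a = 0} = Nat.card {b : B // 2 • b = 0} :=
  Nat.card_congr (e.toEquiv.subtypeEquiv fun a => by
    change _ ↔ 2 • e a = 0
    rw [← map_nsmul, map_eq_zero_iff e e.injective])

theorem card_two_torsion_pi_prod_zmod (k j : ℕ) :
    Nat.card {a : (Fin k → ZMod 2) × ZMod (2 * j + 1) // 2 • a = 0} = 2 ^ k := by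
  have h2 : ∀ a : Fin k → ZMod 2, 2 • a = 0 := fun a => funext fun i => by
    rw [Pi.smul_apply, two_nsmul]
    exact CharTwo.add_self_eq_zero _
  have hodd : ∀ b : ZMod (2 * j + 1), 2 • b = 0 → b = 0 := by
    intro b hb
    have h1 : (2 * j + 1) • b = 0 := by
      rw [nsmul_eq_mul, ZMod.natCast_self, zero_mul]
    rwa [succ_nsmul, mul_nsmul, hb, smul_zero, zero_add] at h1
  let F : {a : (Fin k → ZMod 2) × ZMod (2 * j + 1) // 2 • a = 0} ≃ (Fin k → ZMod 2) :=
    { toFun := fun a => a.1.1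
      invFun := fun a => ⟨(a, 0), by
        rw [Prod.smul_mk, h2, smul_zero, Prod.mk_zero_zero]⟩
      left_inv := fun a => Subtype.ext (Prod.ext rfl (hodd _ (congrArg Prod.snd a.2)).symm)
      right_inv := fun a => rfl }
  rw [Nat.card_congr F, Nat.card_fun, Nat.card_zmod, Nat.card_eq_fintype_card, Fintype.card_fin]

/-- A polynomial in two variables is determined by its values at `(2 ^ k, 2 ^ k * m)`, `m` odd. -/
theorem MvPolynomial.eq_zero_of_eval_two_pow {R : Type*} [CommRing R] [IsDomain R] [CharZero R]
    (p : MvPolynomial (Fin 2) R)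
    (h : ∀ k j : ℕ, eval ![(2 : R) ^ k, 2 ^ k * (2 * j + 1)] p = 0) : p = 0 := by
  have h1 : ∀ (k : ℕ) (x : R), eval ![(2 : R) ^ k, x] p = 0 := by
    intro k
    let q : Polynomial R := aeval ![Polynomial.C ((2 : R) ^ k), Polynomial.X] p
    have hq : ∀ x, q.eval x = eval ![(2 : R) ^ k, x] p := by
      intro x
      have : (Polynomial.aeval x).comp (aeval ![Polynomial.C ((2 : R) ^ k), Polynomial.X]) =
          aeval (R := R) ![(2 : R) ^ k, x] := by
        ext i
        fin_cases i <;> simp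
      simpa [q, Polynomial.coe_aeval_eq_eval, MvPolynomial.coe_aeval_eq_eval] using
        DFunLike.congr_fun this p
    have hq0 : q = 0 := by
      refine Polynomial.eq_zero_of_infinite_isRoot q (Set.Infinite.mono ?_
        (Set.infinite_range_of_injective (f := fun j : ℕ => (2 : R) ^ k * (2 * j + 1)) ?_))
      · rintro _ ⟨j, rfl⟩
        exact (hq _).trans (h k j)
      · intro i j hij
        have := mul_left_cancel₀ (pow_ne_zero k two_ne_zero) hij
        simpa using this
    intro x
    rw [← hq, hq0, Polynomial.eval_zero]
  -- For fixed `k` the infinitely many odd multiples have already removed all restriction on the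
  -- second variable, so the polynomial vanishes on a product of two infinite sets.
  refine MvPolynomial.funext_set ![Set.range fun k : ℕ => (2 : R) ^ k, Set.univ] ?_ ?_
  · intro i
    fin_cases i
    · exact Set.infinite_range_of_injective fun i j hij =>
        Nat.pow_right_injective le_rfl (by exact_mod_cast hij)
    · exact Set.infinite_univ
  · intro x hx
    obtain ⟨k, hk⟩ := hx 0 (Set.mem_univ _)
    have : x = ![(2 : R) ^ k, x 1] := by
      funext i
      fin_cases i
      · exact hk.symm
      · rfl
    rw [this, h1, map_zero]

/-! ### Nowhere-zero flows: inclusion-exclusion, existence and uniqueness -/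

namespace SignedGraph

variable {V : Type u} {E : Type v}

/-- `f` has zero boundary, the value `f e` being taken on the selected arc on `e`. -/
def IsEdgeFlow [Fintype E] [DecidableEq V] (G : SignedGraph V E) {A : Type w} [AddCommGroup A]
    (f : E → A) : Prop :=
  ∀ x, ∑ e, G.incidence x (G.arcOf e) • f e = 0

/-- The selected arc has arrow 1 at the end `true`, so the arrow there distinguishes an arc from its
opposite. -/
theorem chain_apply (G : SignedGraph V E) {A : Type w} [AddCommGroup A] (c : G.chainGroup A)
    (a : G.Arc) : c.1 a = (a.arrow true : ℤ) • c.1 (G.arcOf a.edge) := by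
  rcases a.eq_or_eq_opp with h | h
  · rw [h]
    simp [arcOf]
  · rw [h, c.2 (G.arcOf a.edge)]
    simp [arcOf, Arc.opp]

/-- Chains are functions on edges. -/
def chainEquiv (G : SignedGraph V E) (A : Type w) [AddCommGroup A] : G.chainGroup A ≃ (E → A) where
  toFun c e := c.1 (G.arcOf e)
  invFun f := ⟨fun a => (a.arrow true : ℤ) • f a.edge, fun a => by simp [Arc.opp]⟩
  left_inv c := Subtype.ext (funext fun a => (G.chain_apply c a).symm)
  right_inv f := funext fun e => by simp [arcOf]

theorem card_nowhereZeroFlows [Fintype E] [DecidableEq V] (G : SignedGraph V E) (A : Type w)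
    [AddCommGroup A] : Nat.card (G.nowhereZeroFlows A) =
      Nat.card {f : E → A // G.IsEdgeFlow f ∧ ∀ e, f e ≠ 0} := by
  refine Nat.card_congr ((G.chainEquiv A).subtypeEquiv fun c => ?_)
  refine and_congr funext_iff ⟨fun h e => h _, fun h a => ?_⟩
  rw [chain_apply]
  have := h a.edge
  rcases Int.units_eq_one_or (a.arrow true) with h1 | h1 <;> simpa [h1, chainEquiv] using this

/-- Flows vanishing outside `S` are flows on the edge set `S`. -/
theorem card_isEdgeFlow [Fintype V] [Fintype E] [DecidableEq V] (G : SignedGraph V E)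
    (S : Finset E) (A : Type w) [AddCommGroup A] [Finite A] :
    Nat.card {f : E → A // G.IsEdgeFlow f ∧ ∀ e ∉ S, f e = 0} =
      Nat.card {a : A // 2 • a = 0} ^ G.numCompactUnbalanced S * Nat.card A ^ G.cycleRank S := by
  classical
  rw [← card_ker_edgeBoundary_eq]
  let F : {f : E → A // ∀ e ∉ S, f e = 0} ≃ (S → A) :=
    { toFun := fun f e => f.1 e
      invFun := fun f => ⟨fun e => if h : e ∈ S then f ⟨e, h⟩ else 0, fun e he => dif_neg he⟩
      left_inv := fun f => by
        refine Subtype.ext (funext fun e => ?_)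
        by_cases he : e ∈ S
        · simp [he]
        · simp [he, f.2 e he]
      right_inv := fun f => funext fun e => by simp }
  refine Nat.card_congr (((Equiv.subtypeEquivRight fun f => and_comm).trans
    (Equiv.subtypeSubtypeEquivSubtypeInter _ _).symm).trans (F.subtypeEquiv fun f => ?_))
  rw [AddMonoidHom.mem_ker, funext_iff]
  refine forall_congr' fun x => ?_
  have : ∑ e, G.incidence x (G.arcOf e) • f.1 e = G.edgeBoundary S A (F f) x := by
    change _ = ∑ e : S, G.incidence x (G.arcOf e) • f.1 e
    rw [Finset.sum_coe_sort S fun e => G.incidence x (G.arcOf e) • f.1 e]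
    refine (Finset.sum_subset (Finset.subset_univ S) fun e _ he => ?_).symm
    rw [f.2 e he, smul_zero]
  rw [this, Pi.zero_apply]

theorem card_nowhereZeroFlows_eq_sum [Fintype V] [Fintype E] [DecidableEq V] [DecidableEq E]
    (G : SignedGraph V E) (A : Type w) [AddCommGroup A] [Finite A] :
    (Nat.card (G.nowhereZeroFlows A) : ℤ) = ∑ S : Finset E, (-1) ^ Sᶜ.card *
      ((Nat.card {a : A // 2 • a = 0} : ℤ) ^ G.numCompactUnbalanced S *
        (Nat.card A : ℤ) ^ G.cycleRank S) := by
  classical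
  let Φ := {f : E → A // G.IsEdgeFlow f}
  have : Fintype Φ := Fintype.ofFinite Φ
  let Z : E → Finset Φ := fun e => Finset.univ.filter fun f => f.1 e = 0
  have hnz : Nat.card (G.nowhereZeroFlows A) = (Finset.univ.inf fun e => (Z e)ᶜ).card := by
    rw [card_nowhereZeroFlows, ← Nat.card_congr (Equiv.subtypeSubtypeEquivSubtypeInter
      (fun f : E → A => G.IsEdgeFlow f) (fun f => ∀ e, f e ≠ 0))]
    refine Nat.subtype_card _ fun f => ?_
    simp [Finset.mem_inf, Z]
  have hz : ∀ T : Finset E, (T.inf Z).card =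
      Nat.card {a : A // 2 • a = 0} ^ G.numCompactUnbalanced Tᶜ *
        Nat.card A ^ G.cycleRank Tᶜ := by
    intro T
    rw [← card_isEdgeFlow, ← Nat.card_congr (Equiv.subtypeSubtypeEquivSubtypeInter
      (fun f : E → A => G.IsEdgeFlow f) (fun f => ∀ e ∉ Tᶜ, f e = 0))]
    refine (Nat.subtype_card _ fun f => ?_).symm
    simp [Finset.mem_inf, Z]
  -- Inclusion-exclusion runs over the set `T` on which flows are required to vanish; passing to
  -- complements makes it a sum over the allowed support.
  rw [hnz, Finset.inclusion_exclusion_card_inf_compl, Finset.powerset_univ,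
    ← Equiv.sum_comp (Function.Involutive.toPerm compl compl_involutive)]
  refine Finset.sum_congr rfl fun S _ => ?_
  simp [hz]

/-- If the removal of `e` does not change the number of flows then all flows vanish on `e`. -/
theorem IsEdgeFlow.eq_zero [Fintype V] [Fintype E] [DecidableEq V] [DecidableEq E]
    {G : SignedGraph V E} {e : E}
    (hu : G.numCompactUnbalanced Finset.univ = G.numCompactUnbalanced (Finset.univ.erase e))
    (hc : G.cycleRank Finset.univ = G.cycleRank (Finset.univ.erase e))
    {A : Type w} [AddCommGroup A] [Finite A] {f : E → A} (hf : G.IsEdgeFlow f) : f e = 0 := by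
  have h1 := G.card_isEdgeFlow Finset.univ A
  rw [hu, hc, ← card_isEdgeFlow] at h1
  let F : {f : E → A // G.IsEdgeFlow f ∧ ∀ e' ∉ Finset.univ.erase e, f e' = 0} →
      {f : E → A // G.IsEdgeFlow f ∧ ∀ e ∉ Finset.univ, f e = 0} :=
    fun f => ⟨f.1, f.2.1, by simp⟩
  have hF : Function.Injective F := fun f f' h => by
    have h' := congrArg Subtype.val h
    exact Subtype.ext h'
  -- The flows off `e` inject into all flows, and the two finite sets have the same size, so every
  -- flow is one that vanishes on `e`.
  obtain ⟨f', hf'⟩ := (hF.bijective_of_nat_card_le h1.le).2 ⟨f, hf, by simp⟩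
  have := f'.2.2 e (by simp)
  rwa [show f'.1 = f from congrArg Subtype.val hf'] at this

/-- Over ℤ/6 the number of flows is 2^(u_c + cr) · 3^cr, so the exponents of 3 and 2 recover both
invariants. If all flows vanished on `e`, the counts for E and E∖e would agree, and hence both
invariants. -/
theorem exists_isEdgeFlow_ne_zero [Fintype V] [Fintype E] [DecidableEq V] [DecidableEq E]
    (G : SignedGraph V E) {e : E}
    (h : ¬ (G.numCompactUnbalanced Finset.univ = G.numCompactUnbalanced (Finset.univ.erase e) ∧
      G.cycleRank Finset.univ = G.cycleRank (Finset.univ.erase e))) :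
    ∃ f : E → ULift.{w} (ZMod 6), G.IsEdgeFlow f ∧ f e ≠ 0 := by
  by_contra! hall
  have heq : Nat.card {f : E → ULift.{w} (ZMod 6) //
        G.IsEdgeFlow f ∧ ∀ e' ∉ Finset.univ, f e' = 0} =
      Nat.card {f : E → ULift.{w} (ZMod 6) //
        G.IsEdgeFlow f ∧ ∀ e' ∉ Finset.univ.erase e, f e' = 0} := by
    refine Nat.card_congr (Equiv.subtypeEquivRight fun f => and_congr_right fun hf => ?_)
    simpa using hall f hf
  have h2 : Nat.card {a : ULift.{w} (ZMod 6) // 2 • a = 0} = 2 := by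
    rw [card_two_torsion_congr AddEquiv.ulift, Nat.card_eq_fintype_card]
    decide
  have h6 : Nat.card (ULift.{w} (ZMod 6)) = 2 * 3 := by
    rw [Nat.card_congr Equiv.ulift, Nat.card_zmod]
  rw [card_isEdgeFlow, card_isEdgeFlow, h2, h6] at heq
  have hfac : ∀ a b : ℕ, (2 ^ a * (2 * 3) ^ b).factorization 3 = b ∧
      (2 ^ a * (2 * 3) ^ b).factorization 2 = a + b := by
    intro a b
    rw [mul_pow, ← mul_assoc, ← pow_add, Nat.factorization_mul (by positivity) (by positivity),
      Nat.Prime.factorization_pow Nat.prime_two, Nat.Prime.factorization_pow Nat.prime_three]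
    simp
  have h3 := (hfac _ _).1.symm.trans ((congrArg (fun n => n.factorization 3) heq).trans (hfac _ _).1)
  have h4 := (hfac _ _).2.symm.trans ((congrArg (fun n => n.factorization 2) heq).trans (hfac _ _).2)
  exact h ⟨by omega, h3⟩

/-- There is a nowhere-zero flow over some finite group if each edge supports a nonzero flow. -/
theorem exists_nowhereZero_isEdgeFlow [Fintype V] [Fintype E] [DecidableEq V] [DecidableEq E]
    (G : SignedGraph V E)
    (h : ∀ e, ¬ (G.numCompactUnbalanced Finset.univ = G.numCompactUnbalanced (Finset.univ.erase e) ∧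
      G.cycleRank Finset.univ = G.cycleRank (Finset.univ.erase e))) :
    ∃ f : E → Fin (Fintype.card E) → ULift.{w} (ZMod 6), G.IsEdgeFlow f ∧ ∀ e, f e ≠ 0 := by
  choose f hf hne using fun e => G.exists_isEdgeFlow_ne_zero.{u, v, w} (h e)
  let ι := (Fintype.equivFin E).symm
  -- One coordinate per edge: coordinate `i` is the flow chosen for the edge `ι i`, so the combined
  -- flow is nonzero on each edge in its own coordinate.
  refine ⟨fun e i => f (ι i) e, fun x => funext fun i => ?_, fun e he => ?_⟩
  · rw [Finset.sum_apply]
    exact hf (ι i) x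
  · have := congrFun he (ι.symm e)
    simp only [ι.apply_symm_apply] at this
    exact hne e this

theorem CountsNowhereZeroFlows.unique [Fintype E] [DecidableEq V] {R : Type r} [CommRing R]
    [IsDomain R] [CharZero R] {G : SignedGraph V E} {φ ψ : MvPolynomial (Fin 2) R}
    (hφ : CountsNowhereZeroFlows.{u, v, r, w} G φ) (hψ : CountsNowhereZeroFlows.{u, v, r, w} G ψ) :
    φ = ψ := by
  rw [← sub_eq_zero]
  refine MvPolynomial.eq_zero_of_eval_two_pow _ fun k j => ?_
  let A := ULift.{w} ((Fin k → ZMod 2) × ZMod (2 * j + 1))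
  have ht : Nat.card {a : A // 2 • a = 0} = 2 ^ k := by
    rw [card_two_torsion_congr AddEquiv.ulift, card_two_torsion_pi_prod_zmod]
  have hx : Nat.card A = 2 ^ k * (2 * j + 1) := by
    rw [Nat.card_congr Equiv.ulift, Nat.card_prod, Nat.card_fun, Nat.card_zmod, Nat.card_zmod,
      Nat.card_eq_fintype_card, Fintype.card_fin]
  have h1 := (hφ A).symm.trans (hψ A)
  rw [ht, hx] at h1
  push_cast at h1
  rw [map_sub, h1, sub_self]

theorem countsNowhereZeroFlows_sum [Fintype V] [Fintype E] [DecidableEq V] [DecidableEq E]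
    (G : SignedGraph V E) (R : Type r) [CommRing R] :
    CountsNowhereZeroFlows.{u, v, r, w} G (∑ S : Finset E, (-1) ^ Sᶜ.card *
      (MvPolynomial.X 0 ^ G.numCompactUnbalanced S * MvPolynomial.X 1 ^ G.cycleRank S) :
        MvPolynomial (Fin 2) R) := by
  intro A _ _
  have := congrArg (Int.cast : ℤ → R) (G.card_nowhereZeroFlows_eq_sum A)
  push_cast at this
  rw [this]
  simp

end SignedGraph

/-! ### Effect of adding one edge on components -/

open Classical in
/-- Comparison of the number of elements with a property under a map that is bijective outside the
fibre of `b₀`. -/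
theorem card_subtype_add_ite_eq {α β : Type*} [Fintype α] [Fintype β] (π : α → β) (b₀ : β)
    (hπ : ∀ b ≠ b₀, ∃ a, ∀ a', π a' = b ↔ a' = a) (p : α → Prop) (q : β → Prop)
    (h : ∀ a, π a ≠ b₀ → (p a ↔ q (π a))) :
    Nat.card {a // p a} + (if q b₀ then 1 else 0) =
      Nat.card {b // q b} + ∑ a with π a = b₀, if p a then 1 else 0 := by
  have h1 : Nat.card {a // p a} = ∑ b, ∑ a with π a = b, if p a then 1 else 0 := by
    rw [Nat.card_eq_fintype_card, Fintype.card_subtype, Finset.card_filter]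
    exact (Finset.sum_fiberwise _ π _).symm
  have h2 : Nat.card {b // q b} = ∑ b, if q b then 1 else 0 := by
    rw [Nat.card_eq_fintype_card, Fintype.card_subtype, Finset.card_filter]
  have h3 : ∀ b ∈ Finset.univ.erase b₀,
      (∑ a with π a = b, if p a then 1 else 0) = if q b then 1 else 0 := by
    intro b hb
    obtain ⟨a, ha⟩ := hπ b (Finset.ne_of_mem_erase hb)
    have hab := (ha a).2 rfl
    have : (Finset.univ.filter fun a => π a = b) = {a} := by
      ext a'
      simp [ha]
    rw [this, Finset.sum_singleton]
    simp only [h a (hab ▸ Finset.ne_of_mem_erase hb), hab]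
  rw [h1, h2, ← Finset.add_sum_erase _ _ (Finset.mem_univ b₀),
    ← Finset.add_sum_erase _ (fun b => if q b then 1 else 0) (Finset.mem_univ b₀),
    Finset.sum_congr rfl h3]
  ring

namespace SignedGraph

variable {V : Type u} {E : Type v}

/-- The map of components induced by an inclusion of edge sets. -/
def componentMap (G : SignedGraph V E) {S T : Finset E} (h : S ⊆ T) :
    G.Component S → G.Component T :=
  SimpleGraph.ConnectedComponent.map (SimpleGraph.Hom.ofLE (G.adjGraph_mono h))

theorem componentMap_mk (G : SignedGraph V E) {S T : Finset E} (h : S ⊆ T) (x : V) :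
    G.componentMap h ((G.adjGraph S).connectedComponentMk x) =
      (G.adjGraph T).connectedComponentMk x := rfl

theorem componentMap_surjective (G : SignedGraph V E) {S T : Finset E} (h : S ⊆ T) :
    Function.Surjective (G.componentMap h) := by
  intro K
  induction K using SimpleGraph.ConnectedComponent.ind with
  | _ x => exact ⟨_, G.componentMap_mk h x⟩

theorem mem_componentEdges_insert [DecidableEq E] (G : SignedGraph V E) {S : Finset E} {e : E}
    (K : G.Component (insert e S)) (e' : E) :
    e' ∈ G.componentEdges (insert e S) K ↔
      (∃ L, G.componentMap (Finset.subset_insert e S) L = K ∧ e' ∈ G.componentEdges S L) ∨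
      (e' = e ∧ ∃ x, G.IsEndpoint e x ∧ (G.adjGraph (insert e S)).connectedComponentMk x = K) := by
  constructor
  · rintro ⟨he', x, hx, hK⟩
    rcases Finset.mem_insert.1 he' with rfl | h
    · exact Or.inr ⟨rfl, x, hx, hK⟩
    · exact Or.inl ⟨(G.adjGraph S).connectedComponentMk x, hK, h, x, hx, rfl⟩
  · rintro (⟨L, rfl, h, x, hx, rfl⟩ | ⟨rfl, x, hx, hK⟩)
    · exact ⟨Finset.mem_insert_of_mem h, x, hx, rfl⟩
    · exact ⟨Finset.mem_insert_self _ _, x, hx, hK⟩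

theorem isCompactComponent_insert [DecidableEq E] (G : SignedGraph V E) {S : Finset E} {e : E}
    (he : ¬ G.IsOuterEdge e) (K : G.Component (insert e S)) :
    G.IsCompactComponent (insert e S) K ↔
      ∀ L, G.componentMap (Finset.subset_insert e S) L = K → G.IsCompactComponent S L := by
  simp only [IsCompactComponent, mem_componentEdges_insert]
  constructor
  · exact fun h L hL e' he' => h e' (Or.inl ⟨L, hL, he'⟩)
  · rintro h e' (⟨L, hL, he'⟩ | ⟨rfl, -⟩)
    exacts [h L hL e' he', he]

theorem componentEdges_insert_eq [DecidableEq E] (G : SignedGraph V E) {S : Finset E} {e : E}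
    {K : G.Component (insert e S)} (he : ∀ x, G.IsEndpoint e x →
      (G.adjGraph (insert e S)).connectedComponentMk x ≠ K) {L : G.Component S}
    (hL : ∀ L', G.componentMap (Finset.subset_insert e S) L' = K ↔ L' = L) :
    G.componentEdges (insert e S) K = G.componentEdges S L := by
  ext e'
  rw [mem_componentEdges_insert]
  constructor
  · rintro (⟨L', hL', h⟩ | ⟨-, x, hx, h⟩)
    · rwa [(hL L').1 hL'] at h
    · exact absurd h (he x hx)
  · exact fun h => Or.inl ⟨L, (hL L).2 rfl, h⟩

theorem isCompactComponent_congr (G : SignedGraph V E) {S T : Finset E} {K : G.Component S}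
    {L : G.Component T} (h : G.componentEdges S K = G.componentEdges T L) :
    G.IsCompactComponent S K ↔ G.IsCompactComponent T L := by
  simp only [IsCompactComponent, h]

theorem isBalancedComponent_congr (G : SignedGraph V E) {S T : Finset E} {K : G.Component S}
    {L : G.Component T} (h : G.componentEdges S K = G.componentEdges T L) :
    G.IsBalancedComponent S K ↔ G.IsBalancedComponent T L := by
  simp only [IsBalancedComponent, IsCompactComponent, h]

theorem numBalanced_add_numCompactUnbalanced [Finite V] (G : SignedGraph V E) (S : Finset E) :
    G.numBalanced S + G.numCompactUnbalanced S = Nat.card {K // G.IsCompactComponent S K} := by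
  classical
  have : Fintype (G.Component S) := Fintype.ofFinite _
  have h : ∀ p : G.Component S → Prop, Nat.card {K // p K} = ∑ K, if p K then 1 else 0 := by
    intro p
    rw [Nat.card_eq_fintype_card, Fintype.card_subtype, Finset.card_filter]
  rw [numBalanced, numCompactUnbalanced, h, h, h, ← Finset.sum_add_distrib]
  refine Finset.sum_congr rfl fun K _ => ?_
  by_cases hb : G.IsBalancedComponent S K
  · simp [hb, hb.1]
  · by_cases hc : G.IsCompactComponent S K <;> simp [hb, hc]

section Insert

variable [DecidableEq E] (G : SignedGraph V E) {S : Finset E} {e : E}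

theorem componentMap_bijective_of_reachable
    (h : ∀ x y, G.ends e false = some x → G.ends e true = some y →
      (G.adjGraph S).Reachable x y) :
    Function.Bijective (G.componentMap (Finset.subset_insert e S)) := by
  refine ⟨fun K L hKL => ?_, G.componentMap_surjective _⟩
  induction K using SimpleGraph.ConnectedComponent.ind with | _ x => ?_
  induction L using SimpleGraph.ConnectedComponent.ind with | _ y => ?_
  have hr := SimpleGraph.ConnectedComponent.exact hKL
  refine SimpleGraph.ConnectedComponent.sound ((G.iff_of_reachable
    (p := fun z => (G.adjGraph S).Reachable x z) hr fun e' he' a b ha hb => ?_).1 .rfl)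
  have hab : (G.adjGraph S).Reachable a b := by
    rcases Finset.mem_insert.1 he' with rfl | h'
    exacts [h a b ha hb, G.reachable_of_ends h' ha hb]
  exact ⟨fun h => h.trans hab, fun h => h.trans hab.symm⟩

theorem numComponents_insert_of_reachable
    (h : ∀ x y, G.ends e false = some x → G.ends e true = some y →
      (G.adjGraph S).Reachable x y) :
    G.numComponents S = G.numComponents (insert e S) :=
  Nat.card_eq_of_bijective _ (G.componentMap_bijective_of_reachable h)

/-- The components keep their vertex sets and their compactness, so b + u_c is unchanged; a balanced
component that is lost becomes a compact unbalanced one. -/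
theorem numCompactUnbalanced_insert_ne [Finite V] (he : ¬ G.IsOuterEdge e)
    (h : ∀ x y, G.ends e false = some x → G.ends e true = some y →
      (G.adjGraph S).Reachable x y)
    (hb : G.numBalanced S = G.numBalanced (insert e S) + 1) :
    G.numCompactUnbalanced (insert e S) ≠ G.numCompactUnbalanced S := by
  have hbij := G.componentMap_bijective_of_reachable h
  have : Nat.card {K // G.IsCompactComponent S K} =
      Nat.card {K // G.IsCompactComponent (insert e S) K} := by
    refine Nat.card_congr ((Equiv.ofBijective _ hbij).subtypeEquiv fun K => ?_)
    rw [isCompactComponent_insert G he]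
    refine ⟨fun hK L hL => ?_, fun hK => hK K rfl⟩
    rwa [hbij.1 hL]
  rw [← numBalanced_add_numCompactUnbalanced, ← numBalanced_add_numCompactUnbalanced] at this
  omega

/-- Only the component meeting `e` changes, and it becomes non-compact. If b drops, it was balanced
before, so u_c counts it neither before nor after. -/
theorem numCompactUnbalanced_insert_of_isOuterEdge [Finite V] (he : G.IsOuterEdge e)
    (hb : G.numBalanced S = G.numBalanced (insert e S) + 1) :
    G.numCompactUnbalanced (insert e S) = G.numCompactUnbalanced S := by
  classical
  have : Fintype (G.Component S) := Fintype.ofFinite _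
  have : Fintype (G.Component (insert e S)) := Fintype.ofFinite _
  have hbij := G.componentMap_bijective_of_reachable (S := S)
    fun x y hx hy => absurd he (G.not_isOuterEdge_of_ends hx hy)
  obtain ⟨i, x, hx⟩ := G.exists_end e
  have hend : ∀ z, G.IsEndpoint e z → z = x := by
    rintro z ⟨j, hz⟩
    obtain ⟨k, hk⟩ := he
    cases i <;> cases j <;> cases k <;> simp_all
  set K := (G.adjGraph S).connectedComponentMk x with hK
  set π := G.componentMap (Finset.subset_insert e S) with hπ
  have hfib : ∀ L : G.Component (insert e S), ∃ a, ∀ a', π a' = L ↔ a' = a := by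
    intro L
    obtain ⟨a, rfl⟩ := hbij.2 L
    exact ⟨a, fun a' => hbij.1.eq_iff⟩
  have hedge : ∀ a, π a ≠ π K → G.componentEdges S a = G.componentEdges (insert e S) (π a) := by
    intro a ha
    refine (G.componentEdges_insert_eq (fun z hz h => ha ?_) fun a' => hbij.1.eq_iff).symm
    rw [← h, hend z hz]
    rfl
  have hfilter : (Finset.univ.filter fun a => π a = π K) = {K} := by
    ext a
    simp [hbij.1.eq_iff]
  have hnc : ¬ G.IsCompactComponent (insert e S) (π K) := fun h =>
    h e ⟨Finset.mem_insert_self e S, x, ⟨i, hx⟩, rfl⟩ he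
  have hnb : ¬ G.IsBalancedComponent (insert e S) (π K) := fun h => hnc h.1
  have h1 := card_subtype_add_ite_eq π (π K) (fun b _ => hfib b) (G.IsBalancedComponent S)
    (G.IsBalancedComponent (insert e S)) fun a ha => G.isBalancedComponent_congr (hedge a ha)
  have h2 := card_subtype_add_ite_eq π (π K) (fun b _ => hfib b)
    (fun a => G.IsCompactComponent S a ∧ ¬ G.IsBalancedComponent S a)
    (fun a => G.IsCompactComponent (insert e S) a ∧ ¬ G.IsBalancedComponent (insert e S) a)
    fun a ha => by
      rw [G.isBalancedComponent_congr (hedge a ha), G.isCompactComponent_congr (hedge a ha)]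
  rw [hfilter, Finset.sum_singleton] at h1 h2
  simp only [hnb, hnc, if_false, false_and, add_zero] at h1 h2
  change G.numBalanced S = G.numBalanced (insert e S) + _ at h1
  change G.numCompactUnbalanced S = G.numCompactUnbalanced (insert e S) + _ at h2
  have hKb : G.IsBalancedComponent S K := by
    by_contra hKb
    rw [if_neg hKb] at h1
    omega
  rw [if_neg (by simp [hKb])] at h2
  exact h2.symm

/-- Adding `e` can identify only the components of its two ends: renaming the component of `y` as
that of `x` gives a function `ψ` on vertices that is constant along every edge, `e` included. -/
theorem componentMap_eq_of_not_reachable {x y : V} (hx : G.ends e false = some x)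
    (hy : G.ends e true = some y) {K L : G.Component S}
    (h : G.componentMap (Finset.subset_insert e S) K =
      G.componentMap (Finset.subset_insert e S) L) :
    K = L ∨ ((K = (G.adjGraph S).connectedComponentMk x ∨ K = (G.adjGraph S).connectedComponentMk y)
      ∧ (L = (G.adjGraph S).connectedComponentMk x ∨ L = (G.adjGraph S).connectedComponentMk y)) := by
  classical
  induction K using SimpleGraph.ConnectedComponent.ind with | _ z => ?_
  induction L using SimpleGraph.ConnectedComponent.ind with | _ z' => ?_
  have hr := SimpleGraph.ConnectedComponent.exact h
  let ψ : V → G.Component S := fun a =>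
    if (G.adjGraph S).connectedComponentMk a = (G.adjGraph S).connectedComponentMk y then
      (G.adjGraph S).connectedComponentMk x else (G.adjGraph S).connectedComponentMk a
  have hψ : ψ z' = ψ z := by
    refine (G.iff_of_reachable (p := fun a => ψ a = ψ z) hr fun e' he' a b ha hb => ?_).1 rfl
    have hab : ψ a = ψ b := by
      rcases Finset.mem_insert.1 he' with rfl | h'
      · rw [hx] at ha; rw [hy] at hb; cases ha; cases hb
        simp [ψ]
      · have := SimpleGraph.ConnectedComponent.sound (G.reachable_of_ends h' ha hb)
        simp only [ψ, this]
    rw [hab]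
  simp only [ψ] at hψ
  split_ifs at hψ with h1 h2 h2
  · exact Or.inl (h2.trans h1.symm)
  · exact Or.inr ⟨Or.inl hψ.symm, Or.inr h1⟩
  · exact Or.inr ⟨Or.inr h2, Or.inl hψ⟩
  · exact Or.inl hψ.symm

theorem numComponents_insert_of_not_reachable [Finite V] {x y : V} (hx : G.ends e false = some x) (hy : G.ends e true = some y)
    (hr : ¬ (G.adjGraph S).Reachable x y) :
    G.numComponents S = G.numComponents (insert e S) + 1 ∧
      (G.numBalanced S = G.numBalanced (insert e S) + 1 →
        G.numCompactUnbalanced (insert e S) = G.numCompactUnbalanced S) := by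
  classical
  have : Fintype (G.Component S) := Fintype.ofFinite _
  have : Fintype (G.Component (insert e S)) := Fintype.ofFinite _
  have he := G.not_isOuterEdge_of_ends hx hy
  set K := (G.adjGraph S).connectedComponentMk x with hK
  set L := (G.adjGraph S).connectedComponentMk y with hL
  have hKL : K ≠ L := fun h => hr (SimpleGraph.ConnectedComponent.exact h)
  set π := G.componentMap (Finset.subset_insert e S) with hπ
  have hπKL : π L = π K := (SimpleGraph.ConnectedComponent.sound
    (G.reachable_of_ends (Finset.mem_insert_self e S) hx hy)).symm
  have hfibK : ∀ a, π a = π K ↔ a = K ∨ a = L := by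
    intro a
    constructor
    · intro ha
      rcases G.componentMap_eq_of_not_reachable hx hy ha with h | h
      exacts [Or.inl h, h.1]
    · rintro (rfl | rfl)
      exacts [rfl, hπKL]
  have hinj : ∀ a, π a ≠ π K → ∀ a', π a' = π a ↔ a' = a := by
    intro a ha a'
    refine ⟨fun h => ?_, fun h => h ▸ rfl⟩
    rcases G.componentMap_eq_of_not_reachable hx hy h with h' | h'
    exacts [h', absurd ((hfibK a).2 h'.2) ha]
  have hfib : ∀ b ≠ π K, ∃ a, ∀ a', π a' = b ↔ a' = a := by
    intro b hb
    obtain ⟨a, rfl⟩ := G.componentMap_surjective (Finset.subset_insert e S) b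
    exact ⟨a, hinj a hb⟩
  have hedge : ∀ a, π a ≠ π K → G.componentEdges S a = G.componentEdges (insert e S) (π a) := by
    intro a ha
    refine (G.componentEdges_insert_eq (fun z hz h => ha ?_) (hinj a ha)).symm
    rw [← h]
    rcases G.eq_or_eq_of_isEndpoint hx hy hz with rfl | rfl
    exacts [rfl, hπKL]
  have hfilter : (Finset.univ.filter fun a => π a = π K) = {K, L} := by
    ext a
    simp [hfibK]
  have hcomp : G.IsCompactComponent (insert e S) (π K) ↔
      G.IsCompactComponent S K ∧ G.IsCompactComponent S L := by
    rw [isCompactComponent_insert G he]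
    constructor
    · exact fun h => ⟨h K rfl, h L hπKL⟩
    · rintro ⟨h1, h2⟩ a ha
      rcases (hfibK a).1 ha with rfl | rfl
      exacts [h1, h2]
  have h0 := card_subtype_add_ite_eq π (π K) hfib (fun _ => True) (fun _ => True) fun a ha => Iff.rfl
  have h1 := card_subtype_add_ite_eq π (π K) hfib (G.IsBalancedComponent S)
    (G.IsBalancedComponent (insert e S)) fun a ha => G.isBalancedComponent_congr (hedge a ha)
  have h2 := card_subtype_add_ite_eq π (π K) hfib
    (fun a => G.IsCompactComponent S a ∧ ¬ G.IsBalancedComponent S a)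
    (fun a => G.IsCompactComponent (insert e S) a ∧ ¬ G.IsBalancedComponent (insert e S) a)
    fun a ha => by
      rw [G.isBalancedComponent_congr (hedge a ha), G.isCompactComponent_congr (hedge a ha)]
  rw [hfilter, Finset.sum_pair hKL] at h0 h1 h2
  simp only [Nat.card_subtype_true, if_true] at h0
  change G.numComponents S + 1 = G.numComponents (insert e S) + _ at h0
  change G.numBalanced S + _ = G.numBalanced (insert e S) + _ at h1
  change G.numCompactUnbalanced S + _ = G.numCompactUnbalanced (insert e S) + _ at h2
  -- Two components merge. If b drops by one, then either both parts and the union are balanced, and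
  -- u_c counts none of them, or exactly one part is balanced and the union is not. In the latter
  -- case the union is compact exactly when the unbalanced part is, so u_c is unchanged.
  refine ⟨by omega, fun hb => ?_⟩
  rw [hcomp] at h2
  have hbK : G.IsBalancedComponent S K → G.IsCompactComponent S K := fun h => h.1
  have hbL : G.IsBalancedComponent S L → G.IsCompactComponent S L := fun h => h.1
  by_cases c1 : G.IsBalancedComponent S K <;> by_cases c2 : G.IsBalancedComponent S L <;>
    by_cases c3 : G.IsBalancedComponent (insert e S) (π K) <;>
    by_cases c4 : G.IsCompactComponent S K <;> by_cases c5 : G.IsCompactComponent S L <;>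
    simp [c1, c2, c3, c4, c5] at h1 h2 hbK hbL <;> omega

/-- Adding `e` changes neither the number of compact unbalanced components nor the cycle-rank if
and only if `e` is a co-loop that is a bridge or an outer-edge. -/
theorem numCompactUnbalanced_and_cycleRank_insert_iff [Fintype V] [Finite E] (he : e ∉ S) :
    (G.numCompactUnbalanced (insert e S) = G.numCompactUnbalanced S ∧
      G.cycleRank (insert e S) = G.cycleRank S) ↔
    (G.numBalanced S = G.numBalanced (insert e S) + 1 ∧
      (G.numComponents S = G.numComponents (insert e S) + 1 ∨ G.IsOuterEdge e)) := by
  have h1 := G.cycleRank_add_card S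
  have h2 := G.cycleRank_add_card (insert e S)
  rw [Finset.card_insert_of_notMem he] at h2
  -- One more edge raises |S| by one, so cr = |S| - |V| + b is unchanged exactly when b drops by
  -- one: this is the co-loop condition.
  have hc : G.cycleRank (insert e S) = G.cycleRank S ↔
      G.numBalanced S = G.numBalanced (insert e S) + 1 := by omega
  rw [hc, and_comm]
  refine and_congr_right fun hb => ?_
  by_cases ho : G.IsOuterEdge e
  · simp [ho, G.numCompactUnbalanced_insert_of_isOuterEdge ho hb]
  obtain ⟨x, y, hx, hy⟩ := G.exists_ends_of_not_isOuterEdge ho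
  by_cases hr : (G.adjGraph S).Reachable x y
  · have hr' : ∀ x y, G.ends e false = some x → G.ends e true = some y →
        (G.adjGraph S).Reachable x y := by
      intro x' y' hx' hy'
      rw [hx] at hx'; rw [hy] at hy'; cases hx'; cases hy'; exact hr
    simp [ho, G.numCompactUnbalanced_insert_ne ho hr' hb,
      G.numComponents_insert_of_reachable hr']
  · obtain ⟨h3, h4⟩ := G.numComponents_insert_of_not_reachable hx hy hr
    simp [h3, h4 hb]

end Insert

end SignedGraph

theorem mainTheorem2 {V : Type u} {E : Type v} [Fintype V] [Fintype E] [DecidableEq V]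
    [DecidableEq E] [Nonempty E] (G : SignedGraph V E)
    {R : Type r} [CommRing R] [IsDomain R] [CharZero R] :
    (∃! φ : MvPolynomial (Fin 2) R, G.CountsNowhereZeroFlows.{u, v, r, w} φ) ∧
    ∀ φ : MvPolynomial (Fin 2) R, G.CountsNowhereZeroFlows.{u, v, r, w} φ →
      φ = ∑ S : Finset E, (-1) ^ Sᶜ.card *
          (MvPolynomial.X 0 ^ G.numCompactUnbalanced S * MvPolynomial.X 1 ^ G.cycleRank S) ∧
      (φ = 0 ↔ ∃ e : E, G.IsCoLoop e ∧ (G.IsBridge e ∨ G.IsOuterEdge e)) := by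
  have hsum := SignedGraph.countsNowhereZeroFlows_sum.{u, v, r, w} G R
  have hiff : ∀ e : E, (G.numCompactUnbalanced Finset.univ =
      G.numCompactUnbalanced (Finset.univ.erase e) ∧
      G.cycleRank Finset.univ = G.cycleRank (Finset.univ.erase e)) ↔
      (G.IsCoLoop e ∧ (G.IsBridge e ∨ G.IsOuterEdge e)) := by
    intro e
    have := G.numCompactUnbalanced_and_cycleRank_insert_iff (Finset.notMem_erase e Finset.univ)
    rwa [Finset.insert_erase (Finset.mem_univ e)] at this
  refine ⟨⟨_, hsum, fun ψ hψ => hψ.unique hsum⟩, fun φ hφ => ⟨hφ.unique hsum, ?_, ?_⟩⟩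
  · rintro rfl
    by_contra! hne
    obtain ⟨f, hf, hf0⟩ := G.exists_nowhereZero_isEdgeFlow.{u, v, w} fun e h =>
      have := (hiff e).1 h
      this.2.elim (hne e this.1).1 (hne e this.1).2
    have h0 := hφ (Fin (Fintype.card E) → ULift.{w} (ZMod 6))
    rw [map_zero, Nat.cast_eq_zero, SignedGraph.card_nowhereZeroFlows] at h0
    have : Nonempty {f : E → Fin (Fintype.card E) → ULift.{w} (ZMod 6) //
        G.IsEdgeFlow f ∧ ∀ e, f e ≠ 0} := ⟨⟨f, hf, hf0⟩⟩
    exact Nat.card_pos.ne' h0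
  · rintro ⟨e, he⟩
    obtain ⟨hu, hc⟩ := (hiff e).2 he
    -- All flows vanish on `e`, so there is no nowhere-zero flow and the zero polynomial has the
    -- counting property too.
    refine hφ.unique fun A _ _ => ?_
    have : IsEmpty {f : E → A // G.IsEdgeFlow f ∧ ∀ e, f e ≠ 0} :=
      ⟨fun f => f.2.2 e (f.2.1.eq_zero hu hc)⟩
    rw [SignedGraph.card_nowhereZeroFlows, Nat.card_of_isEmpty, map_zero, Nat.cast_zero]
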